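/- **Setting.** Session types with arithmetic refinements are given by $$A ::= \oplus\{\ell:A_\ell\}_{\ell\in L} \mid \&\{\ell:A_\ell\}_{\ell\in L} \mid A\otimes A \mid A\multimap A \mid \mathbf 1 \mid V[\overline e] \mid ?\{\phi\}.A \mid !\{\phi\}.A \mid \exists n.A \mid \forall n.A$$ with finite label sets $L$, arithmetic expressions $e ::= i \mid e+e \mid e-e \mid i\times e \mid n$ ($i\in\mathbb N$, variables ranging over $\mathbb N$) and propositions $\phi ::= e=e \mid e>e \mid \top\mid\bot\mid\phi\land\phi\mid\phi\lor\phi\mid\lnot\phi\mid\exists n.\phi\mid\forall n.\phi$, interpreted over the natural numbers. A signature $\Sigma$ is a finite set of possibly mutually recursive definitions $V[\overline n]=A$, where $A$ is not itself a type name. A type $A$ with free variables in $\mathcal V$ is valid under a constraint $\mathcal C$ if every arithmetic expression occurring in it denotes a natural number under $\mathcal C$ and the constraints $\phi$ of the enclosing $?\{\phi\}$ and $!\{\phi\}$; every definition in $\Sigma$ must be valid under $\top$. Let $\mathrm{unfold}(V[\overline e])=A[\overline e/\overline n]$ if $V[\overline n]=A$ is in $\Sigma$, and $\mathrm{unfold}(A)=A$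 if $A$ is not a type name. A relation $\mathcal R$ on closed types is an (equirecursive) type bisimulation if $(A,B)\in\mathcal R$ implies that $\mathrm{unfold}(A)$ and $\mathrm{unfold}(B)$ have the same outermost constructor (with the same label set, for choices) and: for $\oplus,\&,\otimes,\multimap$, corresponding components are related by $\mathcal R$; for $?\{\phi\}.A'$ and $?\{\psi\}.B'$ (likewise $!$), either $\phi$ and $\psi$ are both true and $(A',B')\in\mathcal R$, or both are false; for $\exists m.A'$ and $\exists n.B'$ (likewise $\forall$), $(A'[i/m],B'[i/n])\in\mathcal R$ for all $i\in\mathbb N$. An isorecursive type bisimulation is defined likewise, except that unfolding is an explicit communication: $(A,B)\in\mathcal R$ implies either that $A$ and $B$ are both type names and $(\mathrm{unfold}(A),\mathrm{unfold}(B))\in\mathcal R$, or that neither is a type name and the above conditions hold of $A$ and $B$ themselves. Closed types are equal, $A\equiv B$, if some type bisimulation relates them, and $\forall\mathcal V.\,\mathcal C\Rightarrow A\equiv B$ means that $A[\sigma]\equiv B[\sigma]$ for all ground substitutions $\sigma:\mathcal V\to\mathbb N$ satisfying $\mathcal C$. **Theorem.** Type equality is undecidable: there is no algorithm that, given a valid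 signature $\Sigma$, a finite set of variables $\mathcal V$, a constraint $\mathcal C$ over $\mathcal V$, and types $A$ and $B$ over $\Sigma$ and $\mathcal V$ that are valid under $\mathcal C$, decides whether $\forall\mathcal V.\,\mathcal C\Rightarrow A\equiv B$. The same holds when the inputs are restricted to the quantifier-free fragment, in which $\mathcal C$ and all assertions are quantifier-free and all types (in $\Sigma$, $A$ and $B$) are built only from type names, internal choice $\oplus$ and assertions $?\{\phi\}$. Both statements hold for the equirecursive and for the isorecursive reading of type equality. -/

import Mathlib

namespace SessionTypes

/-! ### Arithmetic expressions and propositions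

Variables are de Bruijn indices: `Exp n` and `Prp n` are the expressions and propositions whose
free variables are among `n` given ones, so "closed" means `n = 0`. -/

/-- Arithmetic expressions `e ::= i | e + e | e - e | i * e | n`. -/
inductive Exp (n : ℕ) : Type
  | const (i : ℕ) : Exp n
  | add (a b : Exp n) : Exp n
  | sub (a b : Exp n) : Exp n
  | mul (i : ℕ) (a : Exp n) : Exp n
  | var (x : Fin n) : Exp n

namespace Exp

/-- Simultaneous substitution of expressions for the free variables. -/
def subst {n m : ℕ} (σ : Fin n → Exp m) : Exp n → Exp m
  | const i => const i
  | add a b => add (a.subst σ) (b.subst σ)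
  | sub a b => sub (a.subst σ) (b.subst σ)
  | mul i a => mul i (a.subst σ)
  | var x => σ x

/-- The value of an expression, an integer: subtraction is not truncated. -/
def eval {n : ℕ} (ρ : Fin n → ℕ) : Exp n → ℤ
  | const i => i
  | add a b => a.eval ρ + b.eval ρ
  | sub a b => a.eval ρ - b.eval ρ
  | mul i a => i * a.eval ρ
  | var x => ρ x

/-- A Gödel number of an expression. -/
def code {n : ℕ} : Exp n → ℕ
  | const i => Nat.pair 0 i
  | add a b => Nat.pair 1 (Nat.pair a.code b.code)
  | sub a b => Nat.pair 2 (Nat.pair a.code b.code)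
  | mul i a => Nat.pair 3 (Nat.pair i a.code)
  | var x => Nat.pair 4 x

theorem code_injective {n : ℕ} {a b : Exp n} (h : a.code = b.code) : a = b := by
  induction a generalizing b <;> cases b <;> simp only [code, Nat.pair_eq_pair] at h <;>
    grind

end Exp

/-- The substitution `σ` under a binder; the bound variable is number `0`. -/
def liftSubst {n m : ℕ} (σ : Fin n → Exp m) : Fin (n + 1) → Exp (m + 1) :=
  Fin.cases (.var 0) (fun x => (σ x).subst (fun y => .var y.succ))

/-- Arithmetic propositions
`φ ::= e = e | e > e | ⊤ | ⊥ | φ ∧ φ | φ ∨ φ | ¬ φ | ∃ n. φ | ∀ n. φ`. -/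
inductive Prp : ℕ → Type
  | eq {n : ℕ} (a b : Exp n) : Prp n
  | gt {n : ℕ} (a b : Exp n) : Prp n
  | top {n : ℕ} : Prp n
  | bot {n : ℕ} : Prp n
  | and {n : ℕ} (φ ψ : Prp n) : Prp n
  | or {n : ℕ} (φ ψ : Prp n) : Prp n
  | not {n : ℕ} (φ : Prp n) : Prp n
  | ex {n : ℕ} (φ : Prp (n + 1)) : Prp n
  | all {n : ℕ} (φ : Prp (n + 1)) : Prp n

namespace Prp

def subst : {n m : ℕ} → Prp n → (Fin n → Exp m) → Prp m
  | _, _, eq a b, σ => eq (a.subst σ) (b.subst σ)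
  | _, _, gt a b, σ => gt (a.subst σ) (b.subst σ)
  | _, _, top, _ => top
  | _, _, bot, _ => bot
  | _, _, and φ ψ, σ => and (φ.subst σ) (ψ.subst σ)
  | _, _, or φ ψ, σ => or (φ.subst σ) (ψ.subst σ)
  | _, _, not φ, σ => not (φ.subst σ)
  | _, _, ex φ, σ => ex (φ.subst (liftSubst σ))
  | _, _, all φ, σ => all (φ.subst (liftSubst σ))

/-- Truth under a valuation of the free variables by natural numbers; quantifiers range
over the natural numbers. -/
def Holds : {n : ℕ} → Prp n → (Fin n → ℕ) → Prop
  | _, eq a b, ρ => a.eval ρ = b.eval ρ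
  | _, gt a b, ρ => a.eval ρ > b.eval ρ
  | _, top, _ => True
  | _, bot, _ => False
  | _, and φ ψ, ρ => φ.Holds ρ ∧ ψ.Holds ρ
  | _, or φ ψ, ρ => φ.Holds ρ ∨ ψ.Holds ρ
  | _, not φ, ρ => ¬ φ.Holds ρ
  | _, ex φ, ρ => ∃ i : ℕ, φ.Holds (Fin.cons i ρ)
  | _, all φ, ρ => ∀ i : ℕ, φ.Holds (Fin.cons i ρ)

/-- Truth of a closed proposition. -/
def Valid (φ : Prp 0) : Prop := φ.Holds Fin.elim0

/-- The same proposition in the presence of one more variable (number `0`). -/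
def weaken {n : ℕ} (φ : Prp n) : Prp (n + 1) := φ.subst (fun x => .var x.succ)

/-- No quantifier occurs in the proposition. -/
def QuantifierFree : {n : ℕ} → Prp n → Prop
  | _, eq _ _ => True
  | _, gt _ _ => True
  | _, top => True
  | _, bot => True
  | _, and φ ψ => φ.QuantifierFree ∧ ψ.QuantifierFree
  | _, or φ ψ => φ.QuantifierFree ∧ ψ.QuantifierFree
  | _, not φ => φ.QuantifierFree
  | _, ex _ => False
  | _, all _ => False

/-- A Gödel number of a proposition. -/
def code : {n : ℕ} → Prp n → ℕ
  | _, eq a b => Nat.pair 0 (Nat.pair a.code b.code)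
  | _, gt a b => Nat.pair 1 (Nat.pair a.code b.code)
  | _, top => Nat.pair 2 0
  | _, bot => Nat.pair 3 0
  | _, and φ ψ => Nat.pair 4 (Nat.pair φ.code ψ.code)
  | _, or φ ψ => Nat.pair 5 (Nat.pair φ.code ψ.code)
  | _, not φ => Nat.pair 6 φ.code
  | _, ex φ => Nat.pair 7 φ.code
  | _, all φ => Nat.pair 8 φ.code

theorem code_injective {n : ℕ} {φ ψ : Prp n} (h : φ.code = ψ.code) : φ = ψ := by
  induction φ <;> cases ψ <;> simp only [code, Nat.pair_eq_pair] at h <;>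
    grind [Exp.code_injective]

end Prp

/-- `n; C ⊢ e : nat`: under the constraint `C` the expression `e`, and with it each of its
subexpressions, denotes a natural number. -/
def Exp.IsNat {n : ℕ} (C : Prp n) : Exp n → Prop
  | .const _ => True
  | .add a b => a.IsNat C ∧ b.IsNat C
  | .sub a b => a.IsNat C ∧ b.IsNat C ∧ ∀ ρ : Fin n → ℕ, C.Holds ρ → 0 ≤ (Exp.sub a b).eval ρ
  | .mul _ a => a.IsNat C
  | .var _ => True

/-- `n; C ⊢ φ`: all expressions in the proposition `φ` denote natural numbers under the
constraint `C`. -/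
def Prp.WellFormed : {n : ℕ} → Prp n → Prp n → Prop
  | _, .eq a b, C => a.IsNat C ∧ b.IsNat C
  | _, .gt a b, C => a.IsNat C ∧ b.IsNat C
  | _, .top, _ => True
  | _, .bot, _ => True
  | _, .and φ ψ, C => φ.WellFormed C ∧ ψ.WellFormed C
  | _, .or φ ψ, C => φ.WellFormed C ∧ ψ.WellFormed C
  | _, .not φ, C => φ.WellFormed C
  | _, .ex φ, C => φ.WellFormed C.weaken
  | _, .all φ, C => φ.WellFormed C.weaken

/-- A Gödel number of a family of numbers indexed by a finite set of labels: the list of its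
entries by increasing labels. -/
def branchesCode (L : Finset ℕ) (g : L → ℕ) : ℕ :=
  Encodable.encode (L.sort.attach.map fun l : {l // l ∈ L.sort} =>
    Nat.pair l.1 (g ⟨l.1, (Finset.mem_sort _).1 l.2⟩))

theorem branchesCode_injective {L L' : Finset ℕ} {g : L → ℕ} {g' : L' → ℕ}
    (h : branchesCode L g = branchesCode L' g') :
    ∃ e : L = L', ∀ l : L, g l = g' ⟨l.1, e ▸ l.2⟩ := by
  have h := Encodable.encode_injective h
  have hL : L = L' := by
    have h1 := congrArg (List.map fun c => (Nat.unpair c).1) h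
    simp only [List.map_map, Function.comp_def, Nat.unpair_pair, List.attach_map_subtype_val] at h1
    rw [← Finset.sort_toFinset (s := L) (r := (· ≤ ·)), h1, Finset.sort_toFinset]
  subst hL
  refine ⟨rfl, fun l => ?_⟩
  have h2 := (List.map_inj_left.1 h) ⟨l.1, (Finset.mem_sort _).2 l.2⟩ (List.mem_attach _ _)
  exact (Nat.pair_eq_pair.1 h2).2

/-! ### Session types -/

/-- Session types with arithmetic refinements whose free arithmetic variables are among `n` given
ones, over type names `v : Fin k`, the name `v` taking `ar v` indices. Labels are natural numbers;
a choice is given by its finite label set `L` and one type for each label in `L`. -/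
inductive Ty {k : ℕ} (ar : Fin k → ℕ) : ℕ → Type
  /-- internal choice `⊕{ℓ : A_ℓ}` -/
  | plus {n : ℕ} (L : Finset ℕ) (A : L → Ty ar n) : Ty ar n
  /-- external choice `&{ℓ : A_ℓ}` -/
  | amp {n : ℕ} (L : Finset ℕ) (A : L → Ty ar n) : Ty ar n
  /-- `A ⊗ B` -/
  | tensor {n : ℕ} (A B : Ty ar n) : Ty ar n
  /-- `A ⊸ B` -/
  | lolli {n : ℕ} (A B : Ty ar n) : Ty ar n
  /-- termination `1` -/
  | one {n : ℕ} : Ty ar n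
  /-- a type name with its indices, `V[e₁, …, e_r]` -/
  | name {n : ℕ} (v : Fin k) (e : Fin (ar v) → Exp n) : Ty ar n
  /-- assertion `?{φ}. A` -/
  | assert {n : ℕ} (φ : Prp n) (A : Ty ar n) : Ty ar n
  /-- assumption `!{φ}. A` -/
  | assume {n : ℕ} (φ : Prp n) (A : Ty ar n) : Ty ar n
  /-- existential quantification `∃ n. A` -/
  | ex {n : ℕ} (A : Ty ar (n + 1)) : Ty ar n
  /-- universal quantification `∀ n. A` -/
  | all {n : ℕ} (A : Ty ar (n + 1)) : Ty ar n

namespace Ty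

variable {k : ℕ} {ar : Fin k → ℕ}

def subst : {n m : ℕ} → Ty ar n → (Fin n → Exp m) → Ty ar m
  | _, _, plus L A, σ => plus L (fun l => (A l).subst σ)
  | _, _, amp L A, σ => amp L (fun l => (A l).subst σ)
  | _, _, tensor A B, σ => tensor (A.subst σ) (B.subst σ)
  | _, _, lolli A B, σ => lolli (A.subst σ) (B.subst σ)
  | _, _, one, _ => one
  | _, _, name v e, σ => name v (fun i => (e i).subst σ)
  | _, _, assert φ A, σ => assert (φ.subst σ) (A.subst σ)
  | _, _, assume φ A, σ => assume (φ.subst σ) (A.subst σ)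
  | _, _, ex A, σ => ex (A.subst (liftSubst σ))
  | _, _, all A, σ => all (A.subst (liftSubst σ))

/-- `A[ρ]`: the closed type obtained by substituting numbers for the free variables. -/
def ground {n : ℕ} (A : Ty ar n) (ρ : Fin n → ℕ) : Ty ar 0 :=
  A.subst (fun x => .const (ρ x))

/-- The type is a type name applied to indices. -/
def IsName {n : ℕ} (A : Ty ar n) : Prop :=
  ∃ (v : Fin k) (e : Fin (ar v) → Exp n), A = name v e

/-- `n; C ⊢ A valid`: every arithmetic expression in `A` denotes a natural number under the
constraints known at its occurrence. -/
def Valid : {n : ℕ} → Ty ar n → Prp n → Prop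
  | _, plus _ A, C => ∀ l, (A l).Valid C
  | _, amp _ A, C => ∀ l, (A l).Valid C
  | _, tensor A B, C => A.Valid C ∧ B.Valid C
  | _, lolli A B, C => A.Valid C ∧ B.Valid C
  | _, one, _ => True
  | _, name _ e, C => ∀ i, (e i).IsNat C
  | _, assert φ A, C => φ.WellFormed C ∧ A.Valid (C.and φ)
  | _, assume φ A, C => φ.WellFormed C ∧ A.Valid (C.and φ)
  | _, ex A, C => A.Valid C.weaken
  | _, all A, C => A.Valid C.weaken

/-- The quantifier-free fragment: only type names, internal choice and assertions of
quantifier-free propositions. -/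
def InFragment : {n : ℕ} → Ty ar n → Prop
  | _, plus _ A => ∀ l, (A l).InFragment
  | _, name _ _ => True
  | _, assert φ A => φ.QuantifierFree ∧ A.InFragment
  | _, _ => False

/-- A Gödel number of a type. -/
def code : {n : ℕ} → Ty ar n → ℕ
  | _, plus L A => Nat.pair 0 (branchesCode L fun l => (A l).code)
  | _, amp L A => Nat.pair 1 (branchesCode L fun l => (A l).code)
  | _, tensor A B => Nat.pair 2 (Nat.pair A.code B.code)
  | _, lolli A B => Nat.pair 3 (Nat.pair A.code B.code)
  | _, one => Nat.pair 4 0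
  | _, name v e => Nat.pair 5 (Nat.pair v (Encodable.encode (List.ofFn fun i => (e i).code)))
  | _, assert φ A => Nat.pair 6 (Nat.pair φ.code A.code)
  | _, assume φ A => Nat.pair 7 (Nat.pair φ.code A.code)
  | _, ex A => Nat.pair 8 A.code
  | _, all A => Nat.pair 9 A.code

theorem code_injective {n : ℕ} {A B : Ty ar n} (h : A.code = B.code) : A = B := by
  induction A with
  | plus L A ih =>
    cases B <;> simp only [code, Nat.pair_eq_pair] at h <;> try omega
    obtain ⟨rfl, h⟩ := branchesCode_injective h.2
    congr 1
    exact funext fun l => ih l (h l)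
  | amp L A ih =>
    cases B <;> simp only [code, Nat.pair_eq_pair] at h <;> try omega
    obtain ⟨rfl, h⟩ := branchesCode_injective h.2
    congr 1
    exact funext fun l => ih l (h l)
  | name v e =>
    cases B <;> simp only [code, Nat.pair_eq_pair] at h <;> try omega
    obtain ⟨hv, he⟩ := h.2
    obtain rfl := Fin.ext hv
    have he := List.ofFn_injective (Encodable.encode_injective he)
    congr 1
    exact funext fun i => Exp.code_injective (congrFun he i)
  | _ =>
    cases B <;> simp only [code, Nat.pair_eq_pair] at h <;> grind [Prp.code_injective]

end Ty

/-! ### Signatures and type equality -/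

/-- A signature: finitely many, possibly mutually recursive type definitions
`V_v[n₁, …, n_r] = A` for `v : Fin k`, where `r = arity v`. They are contractive: a defining type
is not itself a type name. -/
structure Signature where
  k : ℕ
  arity : Fin k → ℕ
  body : ∀ v : Fin k, Ty arity (arity v)
  contractive : ∀ v, ¬ (body v).IsName

namespace Signature

/-- All defining types are valid. -/
def Valid (S : Signature) : Prop := ∀ v, (S.body v).Valid .top

def InFragment (S : Signature) : Prop := ∀ v, (S.body v).InFragment

/-- Closed types over the signature. -/
abbrev ClosedTy (S : Signature) : Type := Ty S.arity 0

/-- A type name is replaced by its definition, any other type is unchanged. -/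
def unfold (S : Signature) : S.ClosedTy → S.ClosedTy
  | .name v e => (S.body v).subst e
  | A => A

/-- The closed types `A` and `B`, neither of them a type name, have the same outermost
constructor and their continuations are related by `R`. -/
inductive Matches {S : Signature} (R : S.ClosedTy → S.ClosedTy → Prop) :
    S.ClosedTy → S.ClosedTy → Prop
  | plus (L : Finset ℕ) (A B : L → S.ClosedTy) (h : ∀ l, R (A l) (B l)) :
      Matches R (.plus L A) (.plus L B)
  | amp (L : Finset ℕ) (A B : L → S.ClosedTy) (h : ∀ l, R (A l) (B l)) :
      Matches R (.amp L A) (.amp L B)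
  | tensor (A₁ A₂ B₁ B₂ : S.ClosedTy) (h₁ : R A₁ B₁) (h₂ : R A₂ B₂) :
      Matches R (.tensor A₁ A₂) (.tensor B₁ B₂)
  | lolli (A₁ A₂ B₁ B₂ : S.ClosedTy) (h₁ : R A₁ B₁) (h₂ : R A₂ B₂) :
      Matches R (.lolli A₁ A₂) (.lolli B₁ B₂)
  | one : Matches R .one .one
  | assert (φ ψ : Prp 0) (A B : S.ClosedTy)
      (h : (φ.Valid ∧ ψ.Valid ∧ R A B) ∨ (φ.not.Valid ∧ ψ.not.Valid)) :
      Matches R (.assert φ A) (.assert ψ B)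
  | assume (φ ψ : Prp 0) (A B : S.ClosedTy)
      (h : (φ.Valid ∧ ψ.Valid ∧ R A B) ∨ (φ.not.Valid ∧ ψ.not.Valid)) :
      Matches R (.assume φ A) (.assume ψ B)
  | ex (A B : Ty S.arity 1) (h : ∀ i : ℕ, R (A.ground fun _ => i) (B.ground fun _ => i)) :
      Matches R (.ex A) (.ex B)
  | all (A B : Ty S.arity 1) (h : ∀ i : ℕ, R (A.ground fun _ => i) (B.ground fun _ => i)) :
      Matches R (.all A) (.all B)

/-- Isorecursive matching: unfolding a type name is itself an observable communication (a `fold`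
message), so a type name can only be matched by a type name. -/
inductive IsoMatches {S : Signature} (R : S.ClosedTy → S.ClosedTy → Prop) :
    S.ClosedTy → S.ClosedTy → Prop
  | fold (v w : Fin S.k) (e : Fin (S.arity v) → Exp 0) (f : Fin (S.arity w) → Exp 0)
      (h : R (S.unfold (.name v e)) (S.unfold (.name w f))) :
      IsoMatches R (.name v e) (.name w f)
  | struct (A B : S.ClosedTy) (h : Matches R A B) : IsoMatches R A B

end Signature

/-- The two ways to read recursive type definitions. -/
inductive Reading
  | equirecursive
  | isorecursive

namespace Signature

/-- `R` is a type bisimulation. -/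
def IsBisimulation (S : Signature) (R : S.ClosedTy → S.ClosedTy → Prop) : Reading → Prop
  | .equirecursive => ∀ A B, R A B → Matches R (S.unfold A) (S.unfold B)
  | .isorecursive => ∀ A B, R A B → IsoMatches R A B

/-- Equality `A ≡ B` of closed types. -/
def Equal (S : Signature) (r : Reading) (A B : S.ClosedTy) : Prop :=
  ∃ R : S.ClosedTy → S.ClosedTy → Prop, S.IsBisimulation R r ∧ R A B

/-- A Gödel number of a signature: the list of its arities and defining types. -/
def code (S : Signature) : ℕ :=
  Encodable.encode (List.ofFn fun v => Nat.pair (S.arity v) (S.body v).code)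

theorem code_injective : Function.Injective code := by
  rintro ⟨k, ar, b, c⟩ ⟨k', ar', b', c'⟩ h
  have h := Encodable.encode_injective h
  have hk : k = k' := by simpa using congrArg List.length h
  subst hk
  have h := congrFun (List.ofFn_injective h)
  simp only [Nat.pair_eq_pair] at h
  obtain rfl : ar = ar' := funext fun v => (h v).1
  obtain rfl : b = b' := funext fun v => Ty.code_injective (h v).2
  rfl

end Signature

/-! ### The decision problem -/

/-- An instance `∀ V. C ⇒ A ≡ B` of parametric type equality over a signature, where `V` consists
of `n` variables. -/
structure Problem where
  sig : Signature
  n : ℕ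
  C : Prp n
  A : Ty sig.arity n
  B : Ty sig.arity n

namespace Problem

/-- The presuppositions: the signature is valid, the constraint is well-formed, and both types
are valid under it. -/
def Valid (I : Problem) : Prop :=
  I.sig.Valid ∧ I.C.WellFormed .top ∧ I.A.Valid I.C ∧ I.B.Valid I.C

/-- The instance lies in the quantifier-free fragment with only type definitions, internal choice
and assertions. -/
def InFragment (I : Problem) : Prop :=
  I.sig.InFragment ∧ I.C.QuantifierFree ∧ I.A.InFragment ∧ I.B.InFragment

/-- `∀ V. C ⇒ A ≡ B`: the two types are equal under every ground substitution satisfying `C`. -/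
def Holds (r : Reading) (I : Problem) : Prop :=
  ∀ ρ : Fin I.n → ℕ, I.C.Holds ρ → I.sig.Equal r (I.A.ground ρ) (I.B.ground ρ)

/-- A Gödel number of an instance. -/
def code (I : Problem) : ℕ :=
  Nat.pair I.sig.code (Nat.pair I.n (Nat.pair I.C.code (Nat.pair I.A.code I.B.code)))

theorem code_injective : Function.Injective code := by
  rintro ⟨S, n, C, A, B⟩ ⟨S', n', C', A', B'⟩ h
  simp only [code, Nat.pair_eq_pair] at h
  obtain ⟨hS, hn, hC, hA, hB⟩ := h
  obtain rfl := Signature.code_injective hS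
  subst hn
  rw [Prp.code_injective hC, Ty.code_injective hA, Ty.code_injective hB]

end Problem

/-- The question `Q` is decidable on the instances satisfying `P`: some algorithm, given the Gödel
number of any instance satisfying `P`, terminates with the correct answer. Nothing is required
of it on other inputs. -/
def DecidableOn (P Q : Problem → Prop) : Prop :=
  ∃ d : ℕ →. Bool, Partrec d ∧
    ∀ I : Problem, P I → (Q I → true ∈ d I.code) ∧ (¬ Q I → false ∈ d I.code)

end SessionTypes

/-!
Type equality is a safety property: two types differ iff some finite sequence of communications
leads to a discrepancy. Internal choices make such a sequence branch nondeterministically,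
assertions restrict it by arithmetic tests, and the indices of type names act as registers, so that a signature
in the quantifier-free fragment is a nondeterministic register machine and a discrepancy is a
terminating run.

Every partial recursive function is computed by a program built from linear assignments, tests
`x = y` and `x > y`, sequential composition and nondeterministic iteration
(`Programmable.of_partrec'`), so the halting problem is the question whether a fixed program `p` has
a terminating run on a given input (`exists_prog_dom`). The control states of `p` are the lists of
programs that remain to be executed; only finitely many are reachable from `[p]`
(`ControlSpace.exists_mem`). Each becomes a type name, whose arguments are the registers and a flag.
The flag is never changed, and it is observed only by the assertion `?{flag = 0}` in the final
state. Hence the types for the flags `0` and `1` are unequal if there is a terminating run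
(`ControlSpace.not_rel_of_accepts`). Otherwise the pairs of types for the two flags, at all states
without terminating run, form a bisimulation (`ControlSpace.equal_of_not_accepts`). As every
definition starts with a choice or an assertion, both types unfold in step, and the argument is the
same for both readings of recursion.

The signature depends on `p` alone and the input enters as a constant index, so the reduction is
computable for the simple reason that pairing is (`ControlSpace.computable_code_problem`).
-/

namespace SessionTypes

/-! ### Nondeterministic register programs -/

/-- The atomic actions of a program whose registers are numbered by `ℕ`. -/
inductive Atom : Type
  /-- the assignment `x := c + a * y` -/
  | assign (x c a y : ℕ) : Atom
  /-- proceed only if `x = y` -/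
  | eq (x y : ℕ) : Atom
  /-- proceed only if `x > y` -/
  | gt (x y : ℕ) : Atom

/-- Programs: atomic actions, sequential composition, and nondeterministic iteration. -/
inductive Prog : Type
  | atom (a : Atom) : Prog
  | seq (p q : Prog) : Prog
  | star (p : Prog) : Prog

/-- The condition under which an atomic action can be performed. -/
def Atom.Guard : Atom → (ℕ → ℕ) → Prop
  | assign _ _ _ _, _ => True
  | eq x y, s => s x = s y
  | gt x y, s => s x > s y

/-- The register contents after an atomic action. -/
def Atom.next : Atom → (ℕ → ℕ) → ℕ → ℕ
  | assign x c a y, s => Function.update s x (c + a * s y)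
  | eq _ _, s => s
  | gt _ _, s => s

namespace Prog

/-- `p.Run s t`: some run of `p` on the register contents `s` terminates with `t`. A failed test
blocks a run. -/
def Run : Prog → (ℕ → ℕ) → (ℕ → ℕ) → Prop
  | atom a => fun s t => a.Guard s ∧ t = a.next s
  | seq p q => Relation.Comp p.Run q.Run
  | star p => Relation.ReflTransGen p.Run

/-- The program computes the partial function `f` of the registers `ins` into the register `out`:
every terminating run yields the value of `f` and preserves the other registers below `base`,
and there is such a run if `f` is defined. The registers from `base` on are scratch space. -/
def Computes {n : ℕ} (p : Prog) (f : List.Vector ℕ n →. ℕ) (ins : List.Vector ℕ n)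
    (out base : ℕ) : Prop :=
  (∀ s t, p.Run s t → t out ∈ f (ins.map s) ∧ ∀ r < base, r ≠ out → t r = s r) ∧
    ∀ s, (f (ins.map s)).Dom → ∃ t, p.Run s t

end Prog

/-- The partial function is computed by programs, for every choice of the input and output
registers. The output register may be one of the input registers. -/
def Programmable {n : ℕ} (f : List.Vector ℕ n →. ℕ) : Prop :=
  ∀ (ins : List.Vector ℕ n) (out base : ℕ), (∀ i, ins.get i < base) → out < base →
    ∃ p : Prog, p.Computes f ins out base

theorem vector_map_congr {n : ℕ} {ins : List.Vector ℕ n} {s t : ℕ → ℕ}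
    (h : ∀ i, t (ins.get i) = s (ins.get i)) : ins.map t = ins.map s :=
  List.Vector.ext fun i => by simp [h]

theorem mem_mOfFn {α : Type} : ∀ {n : ℕ} {g : Fin n → Part α} {v : List.Vector α n},
    v ∈ List.Vector.mOfFn g ↔ ∀ i, v.get i ∈ g i
  | 0, g, v => by
    simp only [List.Vector.mOfFn, Part.pure_eq_some, Part.mem_some_iff, IsEmpty.forall_iff,
      iff_true]
    exact v.eq_nil
  | n + 1, g, v => by
    simp only [List.Vector.mOfFn, Part.pure_eq_some, Part.bind_eq_bind, Part.mem_bind_iff,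
      Part.mem_some_iff, Fin.forall_fin_succ, mem_mOfFn]
    constructor
    · rintro ⟨a, ha, w, hw, rfl⟩
      simpa using ⟨ha, hw⟩
    · rintro ⟨h0, h⟩
      exact ⟨_, h0, v.tail, fun i => by simpa using h i, by simp⟩

namespace Programmable

theorem of_assign {n : ℕ} {f : List.Vector ℕ n → ℕ} (c a : ℕ) (y : List.Vector ℕ n → ℕ)
    (h : ∀ (ins : List.Vector ℕ n) (s : ℕ → ℕ), f (ins.map s) = c + a * s (y ins)) :
    Programmable (f : List.Vector ℕ n →. ℕ) := by
  intro ins out base _ _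
  refine ⟨.atom (.assign out c a (y ins)), ?_, ?_⟩
  · rintro s t ⟨-, rfl⟩
    refine ⟨?_, fun r _ hr => ?_⟩
    · simp [Atom.next, h]
    · simp [Atom.next, hr]
  · exact fun s _ => ⟨_, trivial, rfl⟩

/-- Several functions can be evaluated one after the other into consecutive registers. -/
theorem exists_seq {m n : ℕ} {g : Fin n → List.Vector ℕ m →. ℕ} (ins : List.Vector ℕ m)
    (base : ℕ) (hins : ∀ i, ins.get i < base)
    (p : Fin n → Prog) (hp : ∀ i : Fin n, (p i).Computes (g i) ins (base + i) (base + n)) :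
    ∀ j ≤ n, ∃ q : Prog,
      (∀ s t, q.Run s t → (∀ i : Fin n, i < j → t (base + i) ∈ g i (ins.map s)) ∧
        ∀ r < base, t r = s r) ∧
      ∀ s, (∀ i, (g i (ins.map s)).Dom) → ∃ t, q.Run s t
  | 0, _ => by
    refine ⟨.atom (.eq 0 0), ?_, fun s _ => ⟨s, rfl, rfl⟩⟩
    rintro s t ⟨-, rfl⟩
    exact ⟨fun i hi => absurd hi (Nat.not_lt_zero _), fun _ _ => rfl⟩
  | j + 1, hj => by
    obtain ⟨q, hq, hq'⟩ := exists_seq ins base hins p hp j (by omega)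
    obtain ⟨hs, hc⟩ := hp ⟨j, hj⟩
    have key : ∀ s u, q.Run s u → ins.map u = ins.map s := fun s u hu =>
      vector_map_congr fun i => (hq s u hu).2 _ (hins i)
    refine ⟨.seq q (p ⟨j, hj⟩), ?_, ?_⟩
    · rintro s t ⟨u, hu, ht⟩
      obtain ⟨h1, h2⟩ := hs u t ht
      rw [key s u hu] at h1
      refine ⟨fun i hi => ?_, fun r hr => ?_⟩
      · rcases Nat.lt_succ_iff_lt_or_eq.1 hi with hi | hi
        · rw [h2 _ (by omega) (by simp; omega)]
          exact (hq s u hu).1 i hi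
        · obtain rfl : i = ⟨j, hj⟩ := Fin.ext hi
          exact h1
      · rw [h2 r (by omega) (by simp; omega), (hq s u hu).2 r hr]
    · intro s h
      obtain ⟨u, hu⟩ := hq' s h
      obtain ⟨t, ht⟩ := hc u (by rw [key s u hu]; exact h _)
      exact ⟨t, u, hu, ht⟩

theorem comp {m n : ℕ} {f : List.Vector ℕ n →. ℕ} {g : Fin n → List.Vector ℕ m →. ℕ}
    (hf : Programmable f) (hg : ∀ i, Programmable (g i)) :
    Programmable fun v => List.Vector.mOfFn (fun i => g i v) >>= f := by
  intro ins out base hins hout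
  choose p hp using fun i : Fin n => hg i ins (base + i) (base + n)
    (fun k => (hins k).trans_le (by omega)) (by omega)
  obtain ⟨q, hq, hq'⟩ := exists_seq ins base hins p hp n le_rfl
  obtain ⟨p', hs, hc⟩ := hf (List.Vector.ofFn fun i => base + i) out (base + n) (by simp)
    (by omega)
  have key : ∀ s u, q.Run s u → (List.Vector.ofFn fun i : Fin n => base + (i : ℕ)).map u ∈
      List.Vector.mOfFn (fun i => g i (ins.map s)) := fun s u hu =>
    mem_mOfFn.2 fun i => by simpa using (hq s u hu).1 i i.2
  refine ⟨.seq q p', ?_, ?_⟩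
  · rintro s t ⟨u, hu, ht⟩
    obtain ⟨h1, h2⟩ := hs u t ht
    refine ⟨Part.mem_bind_iff.2 ⟨_, key s u hu, h1⟩, fun r hr hr' => ?_⟩
    rw [h2 r (by omega) hr', (hq s u hu).2 r hr]
  · intro s h
    obtain ⟨y, hy⟩ := Part.dom_iff_mem.1 h
    obtain ⟨w, hw, hy⟩ := Part.mem_bind_iff.1 hy
    obtain ⟨u, hu⟩ := hq' s fun i => Part.dom_iff_mem.2 ⟨_, mem_mOfFn.1 hw i⟩
    obtain rfl := Part.mem_unique hw (key s u hu)
    obtain ⟨t, ht⟩ := hc u (Part.dom_iff_mem.2 ⟨y, hy⟩)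
    exact ⟨t, u, hu, ht⟩

theorem prec {n : ℕ} {f : List.Vector ℕ n → ℕ} {g : List.Vector ℕ (n + 2) → ℕ}
    (hf : Programmable (f : List.Vector ℕ n →. ℕ))
    (hg : Programmable (g : List.Vector ℕ (n + 2) →. ℕ)) :
    Programmable ((fun v : List.Vector ℕ (n + 1) =>
      v.head.rec (f v.tail) fun y IH => g (y ::ᵥ IH ::ᵥ v.tail) : List.Vector ℕ (n + 1) → ℕ) :
        List.Vector ℕ (n + 1) →. ℕ) := by
  intro ins out base hins hout
  have hhead : ins.head < base := by simpa using hins 0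
  have htail : ∀ i, ins.tail.get i < base := fun i => by simpa using hins i.succ
  -- register `base` counts the steps, register `base + 1` holds the value reached so far
  obtain ⟨p, hp, hp'⟩ := hf ins.tail (base + 1) (base + 2) (fun i => (htail i).trans (by omega))
    (by omega)
  obtain ⟨q, hq, hq'⟩ := hg (base ::ᵥ (base + 1) ::ᵥ ins.tail) (base + 1) (base + 2)
    (by
      refine Fin.cases (by simp) (Fin.cases (by show base + 1 < base + 2; omega) fun i => ?_)
      simpa using (htail i).trans (by omega)) (by omega)
  let val (s : ℕ → ℕ) (k : ℕ) : ℕ :=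
    k.rec (f (ins.tail.map s)) fun y IH => g (y ::ᵥ IH ::ᵥ ins.tail.map s)
  let loop : Prog := .seq q (.atom (.assign base 1 1 base))
  let Inv (s t : ℕ → ℕ) : Prop := t (base + 1) = val s (t base) ∧ ∀ r < base, t r = s r
  have hstart : ∀ s t, (Prog.seq p (.atom (.assign base 0 0 0))).Run s t →
      Inv s t ∧ t base = 0 := by
    rintro s t ⟨u, hu, -, rfl⟩
    obtain ⟨h1, h2⟩ := hp s u hu
    simp only [PFun.coe_val, Part.mem_some_iff] at h1
    refine ⟨⟨?_, fun r hr => ?_⟩, ?_⟩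
    · simp [Atom.next, val, h1]
    · simp only [Atom.next]
      rw [Function.update_of_ne (by omega), h2 r (by omega) (by omega)]
    · simp [Atom.next]
  have hloop : ∀ s t u, Inv s t → loop.Run t u → Inv s u ∧ u base = t base + 1 := by
    rintro s t u ⟨h1, h2⟩ ⟨w, hw, -, rfl⟩
    obtain ⟨h3, h4⟩ := hq t w hw
    have h5 : ins.tail.map t = ins.tail.map s := vector_map_congr fun i => h2 _ (htail i)
    have h6 : w base = t base := h4 _ (by omega) (by omega)
    simp only [PFun.coe_val, Part.mem_some_iff, List.Vector.map_cons, h1, h5] at h3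
    refine ⟨⟨?_, fun r hr => ?_⟩, ?_⟩
    · simp only [Atom.next]
      rw [Function.update_of_ne (by omega), Function.update_self, h6, h3, one_mul, add_comm 1]
    · simp only [Atom.next]
      rw [Function.update_of_ne (by omega), h4 r (by omega) (by omega), h2 r hr]
    · simp [Atom.next, h6, add_comm]
  -- The iteration may stop after any number of steps; the test afterwards admits the right one.
  refine ⟨.seq (.seq p (.atom (.assign base 0 0 0)))
    (.seq (.star loop) (.seq (.atom (.eq base ins.head)) (.atom (.assign out 0 1 (base + 1))))),
    ?_, ?_⟩
  · rintro s t ⟨u, hu, _, hw, w, ⟨heq, rfl⟩, -, rfl⟩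
    have hw : Inv s w := by
      clear * - hstart hloop hu hw
      induction hw with
      | refl => exact (hstart s u hu).1
      | tail _ h ih => exact (hloop s _ _ ih h).1
    have heq : w base = s ins.head := by rw [heq, hw.2 _ hhead]
    refine ⟨?_, fun r hr hr' => ?_⟩
    · simp only [Atom.next, Function.update_self, PFun.coe_val, Part.mem_some_iff, hw.1, heq,
        zero_add, one_mul, val, List.Vector.head_map, List.Vector.tail_map]
    · simp only [Atom.next]
      rw [Function.update_of_ne hr', hw.2 r hr]
  · intro s _
    obtain ⟨u, hu⟩ := hp' s trivial
    have hu : (Prog.seq p (.atom (.assign base 0 0 0))).Run s _ := ⟨u, hu, trivial, rfl⟩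
    have hreach : ∀ k, ∃ w, (Prog.star loop).Run
        (Atom.next (.assign base 0 0 0) u) w ∧ Inv s w ∧ w base = k := by
      intro k
      induction k with
      | zero => exact ⟨_, .refl, hstart s _ hu⟩
      | succ k ih =>
        obtain ⟨w, hw, h1, h2⟩ := ih
        obtain ⟨t, ht⟩ := hq' w trivial
        have ht : loop.Run w _ := ⟨t, ht, trivial, rfl⟩
        exact ⟨_, hw.tail ht, (hloop s _ _ h1 ht).1, by rw [(hloop s _ _ h1 ht).2, h2]⟩
    obtain ⟨w, hw, h1, h2⟩ := hreach (s ins.head)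
    exact ⟨_, _, hu, w, hw, w, ⟨by rw [Atom.Guard, h2, h1.2 _ hhead], rfl⟩, trivial, rfl⟩

theorem rfind {n : ℕ} {f : List.Vector ℕ (n + 1) → ℕ}
    (hf : Programmable (f : List.Vector ℕ (n + 1) →. ℕ)) :
    Programmable fun v : List.Vector ℕ n =>
      Nat.rfind fun i => Part.some (decide (f (i ::ᵥ v) = 0)) := by
  intro ins out base hins hout
  -- register `base` is the search index, `base + 1` the value there, `base + 2` holds zero
  obtain ⟨p, hp, hp'⟩ := hf (base ::ᵥ ins) (base + 1) (base + 3)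
    (Fin.cases (by simp) fun i => by simpa using (hins i).trans (by omega)) (by omega)
  let loop : Prog := .seq p (.seq (.atom (.gt (base + 1) (base + 2)))
    (.atom (.assign base 1 1 base)))
  let start : Prog := .seq (.atom (.assign base 0 0 0)) (.atom (.assign (base + 2) 0 0 0))
  let Inv (s t : ℕ → ℕ) : Prop :=
    (∀ k < t base, f (k ::ᵥ ins.map s) ≠ 0) ∧ t (base + 2) = 0 ∧ ∀ r < base, t r = s r
  have heval : ∀ s t u, Inv s t → p.Run t u → u (base + 1) = f (t base ::ᵥ ins.map s) ∧
      u base = t base ∧ u (base + 2) = 0 ∧ ∀ r < base, u r = s r := by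
    rintro s t u ⟨-, h2, h3⟩ hu
    obtain ⟨h4, h5⟩ := hp t u hu
    have h6 : ins.map t = ins.map s := vector_map_congr fun i => h3 _ (hins i)
    simp only [PFun.coe_val, Part.mem_some_iff, List.Vector.map_cons, h6] at h4
    exact ⟨h4, h5 _ (by omega) (by omega), by rw [h5 _ (by omega) (by omega), h2],
      fun r hr => by rw [h5 r (by omega) (by omega), h3 r hr]⟩
  have hstart : ∀ s t, start.Run s t → Inv s t ∧ t base = 0 := by
    rintro s t ⟨_, ⟨-, rfl⟩, -, rfl⟩
    refine ⟨⟨?_, ?_, fun r hr => ?_⟩, ?_⟩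
    · simp [Atom.next]
    · simp [Atom.next]
    · simp only [Atom.next]
      rw [Function.update_of_ne (by omega), Function.update_of_ne (by omega)]
    · simp [Atom.next]
  have hloop : ∀ s t u, Inv s t → loop.Run t u → Inv s u ∧ u base = t base + 1 := by
    rintro s t u h ⟨_, hw, w, ⟨hgt, rfl⟩, -, rfl⟩
    obtain ⟨h1, h2, h3, h4⟩ := heval s t w h hw
    have h5 : Atom.next (.assign base 1 1 base) w base = t base + 1 := by
      simp [Atom.next, h2, add_comm]
    refine ⟨⟨fun k hk => ?_, ?_, fun r hr => ?_⟩, h5⟩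
    · rcases Nat.lt_succ_iff_lt_or_eq.1 (hk.trans_eq h5) with hk | hk
      · exact h.1 k hk
      · rw [hk, ← h1]
        exact (Nat.zero_le _).trans_lt hgt |>.ne'
    · simp [Atom.next, h3]
    · simp only [Atom.next]
      rw [Function.update_of_ne (by omega), h4 r hr]
  -- `loop` only steps past indices with a nonzero value, so the final test finds the least zero.
  refine ⟨.seq start (.seq (.star loop) (.seq p
    (.seq (.atom (.eq (base + 1) (base + 2))) (.atom (.assign out 0 1 base))))), ?_, ?_⟩
  · rintro s t ⟨u, hu, w, hw, _, hw', w', ⟨heq, rfl⟩, -, rfl⟩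
    have hw : Inv s w := by
      clear * - hstart hloop hu hw
      induction hw with
      | refl => exact (hstart s u hu).1
      | tail _ h ih => exact (hloop s _ _ ih h).1
    obtain ⟨h1, h2, h3, h4⟩ := heval s w w' hw hw'
    refine ⟨Nat.mem_rfind.2 ?_, fun r hr hr' => ?_⟩
    · have hout : Atom.next (.assign out 0 1 base) w' out = w base := by simp [Atom.next, h2]
      simp only [Atom.Guard] at heq
      rw [hout]
      exact ⟨by simp [← h1, heq, h3], fun {m} hm => by simpa using hw.1 m hm⟩
    · simp only [Atom.next]
      rw [Function.update_of_ne hr', h4 r hr]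
  · intro s h
    obtain ⟨N, hN⟩ := Part.dom_iff_mem.1 h
    obtain ⟨hN, hlt⟩ := Nat.mem_rfind.1 hN
    have hN : f (N ::ᵥ ins.map s) = 0 := by simpa using hN
    have hlt : ∀ m < N, f (m ::ᵥ ins.map s) ≠ 0 := fun m hm => by simpa using hlt hm
    have hu : start.Run s _ := ⟨_, ⟨trivial, rfl⟩, trivial, rfl⟩
    have hreach : ∀ k ≤ N, ∃ w, (Prog.star loop).Run
        (Atom.next (.assign (base + 2) 0 0 0) (Atom.next (.assign base 0 0 0) s)) w ∧
        Inv s w ∧ w base = k := by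
      intro k hk
      induction k with
      | zero => exact ⟨_, .refl, hstart s _ hu⟩
      | succ k ih =>
        obtain ⟨w, hw, h1, h2⟩ := ih (by omega)
        obtain ⟨t, ht⟩ := hp' w trivial
        obtain ⟨h3, h4, h5, h6⟩ := heval s w t h1 ht
        have ht : loop.Run w (Atom.next (.assign base 1 1 base) t) := ⟨t, ht, t, ⟨by
          rw [Atom.Guard, h3, h5, h2]
          exact Nat.pos_of_ne_zero (hlt k hk), rfl⟩, trivial, rfl⟩
        exact ⟨_, hw.tail ht, (hloop s _ _ h1 ht).1, by rw [(hloop s _ _ h1 ht).2, h2]⟩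
    obtain ⟨w, hw, h1, h2⟩ := hreach N le_rfl
    obtain ⟨t, ht⟩ := hp' w trivial
    obtain ⟨h3, h4, h5, h6⟩ := heval s w t h1 ht
    exact ⟨_, _, hu, w, hw, t, ht, t, ⟨by rw [Atom.Guard, h3, h5, h2, hN], rfl⟩, trivial, rfl⟩

theorem of_primrec' {n : ℕ} {f : List.Vector ℕ n → ℕ} (hf : Nat.Primrec' f) :
    Programmable (f : List.Vector ℕ n →. ℕ) := by
  induction hf with
  | zero => exact of_assign 0 0 (fun _ => 0) fun _ _ => by simp
  | succ => exact of_assign 1 1 List.Vector.head fun _ _ => by simp [add_comm]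
  | get i => exact of_assign 0 1 (fun ins => ins.get i) fun _ _ => by simp
  | comp g _ _ hf hg =>
    refine (congrArg Programmable (funext fun v => ?_)).mpr (comp hf hg)
    simp only [PFun.coe_val, Vector.mOfFn_part_some]
    exact (Part.bind_some _ _).symm
  | prec _ _ hf hg => exact prec hf hg

theorem of_partrec' {n : ℕ} {f : List.Vector ℕ n →. ℕ} (hf : Nat.Partrec' f) :
    Programmable f := by
  induction hf with
  | prim hf => exact of_primrec' hf
  | comp g _ _ hf hg => exact comp hf hg
  | rfind _ hf => exact rfind hf

end Programmable

/-- The domain of a partial recursive function is the set of inputs, in register `0`, on which some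
program has a terminating run. -/
theorem exists_prog_dom {f : ℕ →. ℕ} (hf : Partrec f) :
    ∃ p : Prog, ∀ s, (∃ t, p.Run s t) ↔ (f (s 0)).Dom := by
  obtain ⟨p, hp, hp'⟩ := Programmable.of_partrec' (Nat.Partrec'.part_iff₁.2 hf)
    (0 ::ᵥ List.Vector.nil) 0 1 (by simp) (by simp)
  refine ⟨p, fun s => ⟨?_, fun h => hp' s (by simpa using h)⟩⟩
  rintro ⟨t, ht⟩
  simpa using Part.dom_iff_mem.2 ⟨_, (hp s t ht).1⟩

/-! ### Values of substituted expressions and propositions -/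

theorem Exp.eval_subst {n m : ℕ} {σ : Fin n → Exp m} {ρ : Fin m → ℕ} {ρ' : Fin n → ℕ}
    (h : ∀ i, (σ i).eval ρ = ρ' i) (e : Exp n) : (e.subst σ).eval ρ = e.eval ρ' := by
  induction e <;> simp_all [Exp.subst, Exp.eval]

theorem Prp.holds_subst {n : ℕ} (φ : Prp n) : ∀ {m : ℕ} {σ : Fin n → Exp m} {ρ : Fin m → ℕ}
    {ρ' : Fin n → ℕ}, (∀ i, (σ i).eval ρ = ρ' i) → ((φ.subst σ).Holds ρ ↔ φ.Holds ρ') := by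
  have lift : ∀ {n m : ℕ} {σ : Fin n → Exp m} {ρ : Fin m → ℕ} {ρ' : Fin n → ℕ},
      (∀ i, (σ i).eval ρ = ρ' i) → ∀ (k : ℕ) (i : Fin (n + 1)),
        (liftSubst σ i).eval (Fin.cons k ρ) = ((Fin.cons k ρ' : Fin (n + 1) → ℕ) i : ℤ) := by
    intro n m σ ρ ρ' h k
    refine Fin.cases (by simp [liftSubst, Exp.eval]) fun i => ?_
    simp only [liftSubst, Fin.cases_succ, Fin.cons_succ]
    rw [Exp.eval_subst (ρ' := ρ) (fun _ => by simp [Exp.eval]), h]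
  induction φ with
  | ex φ ih => exact fun h => exists_congr fun k => ih (lift h k)
  | all φ ih => exact fun h => forall_congr' fun k => ih (lift h k)
  | eq a b => intro _ _ _ _ h; simp [Prp.subst, Prp.Holds, Exp.eval_subst h]
  | gt a b => intro _ _ _ _ h; simp [Prp.subst, Prp.Holds, Exp.eval_subst h]
  | top => exact fun _ => Iff.rfl
  | bot => exact fun _ => Iff.rfl
  | and φ ψ ih ih' => exact fun h => and_congr (ih h) (ih' h)
  | or φ ψ ih ih' => exact fun h => or_congr (ih h) (ih' h)
  | not φ ih => exact fun h => not_congr (ih h)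

/-! ### Continuations of a program -/

namespace Prog

/-- A list of programs, to be executed one after the other, has a terminating run. -/
def Accepts : List Prog → (ℕ → ℕ) → Prop
  | [], _ => True
  | p :: l, s => ∃ t, p.Run s t ∧ Accepts l t

/-- The lists of programs that can remain to be executed after one step. -/
def succs : List Prog → Set (List Prog)
  | [] => ∅
  | atom _ :: l => {l}
  | seq p q :: l => {p :: q :: l}
  | star p :: l => {l, p :: star p :: l}

/-- The lists of programs that can remain to be executed in a run of `p :: l` before `p` is
finished. -/
def conts : Prog → List Prog → Set (List Prog)
  | atom a, l => {atom a :: l}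
  | seq p q, l => insert (seq p q :: l) (p.conts (q :: l) ∪ q.conts l)
  | star p, l => insert (star p :: l) (p.conts (star p :: l))

theorem mem_conts (p : Prog) (l : List Prog) : p :: l ∈ p.conts l := by
  cases p <;> simp [conts]

theorem finite_conts (p : Prog) : ∀ l, (p.conts l).Finite := by
  induction p with
  | atom a => exact fun l => Set.finite_singleton _
  | seq p q ihp ihq => exact fun l => ((ihp _).union (ihq _)).insert _
  | star p ih => exact fun l => (ih _).insert _

theorem succs_subset_conts (p : Prog) : ∀ l, ∀ c ∈ p.conts l, succs c ⊆ insert l (p.conts l) := by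
  induction p with
  | atom a =>
    rintro l c rfl
    simp [succs]
  | seq p q ihp ihq =>
    rintro l c (rfl | hc | hc) d hd
    · obtain rfl := hd
      exact .inr (.inr (.inl (mem_conts _ _)))
    · rcases ihp _ c hc hd with rfl | hd
      · exact .inr (.inr (.inr (mem_conts _ _)))
      · exact .inr (.inr (.inl hd))
    · rcases ihq _ c hc hd with rfl | hd
      · exact .inl rfl
      · exact .inr (.inr (.inr hd))
  | star p ih =>
    rintro l c (rfl | hc) d hd
    · rcases hd with rfl | rfl
      · exact .inl rfl
      · exact .inr (.inr (mem_conts _ _))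
    · rcases ih _ c hc hd with rfl | hd
      · exact .inr (.inl rfl)
      · exact .inr (.inr hd)

end Prog

/-- A strict upper bound for the registers that occur in an atomic action. -/
def Atom.bound : Atom → ℕ
  | assign x _ _ y => max x y + 1
  | eq x y => max x y + 1
  | gt x y => max x y + 1

/-- A finite set of control states, closed under steps and numbered by `Fin k`, with a number `N`
of registers that suffices for them. A control state is the list of programs that remain to be
executed. -/
structure ControlSpace where
  carrier : Set (List Prog)
  k : ℕ
  N : ℕ
  state : Fin k → List Prog
  idx : List Prog → Fin k
  state_idx : ∀ l ∈ carrier, state (idx l) = l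
  succs_subset : ∀ l ∈ carrier, Prog.succs l ⊆ carrier
  bound_le : ∀ a l, .atom a :: l ∈ carrier → a.bound ≤ N

theorem ControlSpace.exists_mem (p : Prog) : ∃ W : ControlSpace, [p] ∈ W.carrier := by
  let Q : Set (List Prog) := insert [] (p.conts [])
  have hQ : Q.Finite := (p.finite_conts []).insert _
  obtain ⟨k, ⟨e⟩⟩ := @Finite.exists_equiv_fin Q hQ
  let headBound : List Prog → ℕ := fun l => match l with
    | .atom a :: _ => a.bound
    | _ => 0
  obtain ⟨N, hN⟩ := (hQ.image headBound).bddAbove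
  classical
  refine ⟨⟨Q, k, N, fun i => e.symm i,
    fun l => if h : l ∈ Q then e ⟨l, h⟩ else e ⟨[], .inl rfl⟩, ?_, ?_, ?_⟩,
    .inr (p.mem_conts [])⟩
  · intro l hl
    simp [hl]
  · rintro l (rfl | hl)
    · exact Set.empty_subset _
    · exact p.succs_subset_conts [] l hl
  · exact fun a l h => hN ⟨_, h, rfl⟩

/-! ### The signature of a program -/

/-- Register contents preceded by a flag. -/
def withFlag (b : ℕ) (s : ℕ → ℕ) : ℕ → ℕ
  | 0 => b
  | r + 1 => s r

/-- Register `x` as an expression in `N + 1` variables, of which number `0` is the flag. -/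
def reg (N x : ℕ) : Exp (N + 1) := .var (Fin.ofNat (N + 1) (x + 1))

/-- The condition of an atomic action as a proposition about `N` registers. -/
def Atom.guardPrp (N : ℕ) : Atom → Prp (N + 1)
  | assign _ _ _ _ => .top
  | eq x y => .eq (reg N x) (reg N y)
  | gt x y => .gt (reg N x) (reg N y)

/-- The contents of the flag and `N` registers after an atomic action. -/
def Atom.update (N : ℕ) : Atom → Fin (N + 1) → Exp (N + 1)
  | assign x c a y => fun i =>
    if (i : ℕ) = x + 1 then .add (.const c) (.mul a (reg N y)) else .var i
  | eq _ _ => .var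
  | gt _ _ => .var

theorem eval_reg {N x : ℕ} (h : x < N) (b : ℕ) (s : ℕ → ℕ) :
    (reg N x).eval (fun i => withFlag b s i) = s x := by
  simp [reg, Exp.eval, Nat.mod_eq_of_lt (Nat.succ_lt_succ h), withFlag]

theorem Atom.holds_guardPrp {N : ℕ} {a : Atom} (h : a.bound ≤ N) (b : ℕ) (s : ℕ → ℕ) :
    (a.guardPrp N).Holds (fun i => withFlag b s i) ↔ a.Guard s := by
  cases a <;> simp only [Atom.bound] at h <;> simp only [Atom.guardPrp, Prp.Holds, Atom.Guard]
  all_goals rw [eval_reg (by omega), eval_reg (by omega)]; norm_cast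

theorem Atom.eval_update {N : ℕ} {a : Atom} (h : a.bound ≤ N) (b : ℕ) (s : ℕ → ℕ)
    (i : Fin (N + 1)) :
    (a.update N i).eval (fun i => withFlag b s i) = withFlag b (a.next s) i := by
  cases a with
  | assign x c a y =>
    simp only [Atom.bound] at h
    simp only [Atom.update, Atom.next]
    split_ifs with hi
    · rw [hi, Exp.eval, Exp.eval, Exp.eval, eval_reg (by omega)]
      simp [withFlag]
    · obtain ⟨_ | r, hr⟩ := i
      · rfl
      · have : r ≠ x := by simpa using hi
        simp [Exp.eval, withFlag, this]
  | eq => rfl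
  | gt => rfl

/-- The type that describes a control state. Its variables are the flag and the registers.
Labels resolve the nondeterminism of the program, assertions express its tests, and the final
state shows whether the flag is `0`. -/
def stateTy {k : ℕ} (N : ℕ) (idx : List Prog → Fin k) :
    List Prog → Ty (fun _ : Fin k => N + 1) (N + 1)
  | [] => .assert (.eq (.var 0) (.const 0)) (.name (idx []) .var)
  | .atom a :: l => .assert (a.guardPrp N) (.name (idx l) (a.update N))
  | .seq p q :: l => .plus {0} fun _ => .name (idx (p :: q :: l)) .var
  | .star p :: l => .plus {0, 1} fun c =>
    .name (idx (if (c : ℕ) = 0 then l else p :: .star p :: l)) .var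

theorem not_isName_stateTy {k N : ℕ} (idx : List Prog → Fin k) (l : List Prog) :
    ¬ (stateTy N idx l).IsName := by
  unfold stateTy
  split <;> simp [Ty.IsName]

theorem Ty.not_isName_subst {k : ℕ} {ar : Fin k → ℕ} {n m : ℕ} {A : Ty ar n} (h : ¬ A.IsName)
    (σ : Fin n → Exp m) : ¬ (A.subst σ).IsName := by
  cases A <;> simp [Ty.IsName, Ty.subst] at h ⊢

theorem isNat_reg {N x : ℕ} (C : Prp (N + 1)) : (reg N x).IsNat C := trivial

theorem Atom.isNat_update {N : ℕ} (a : Atom) (C : Prp (N + 1)) (i : Fin (N + 1)) :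
    (a.update N i).IsNat C := by
  cases a with
  | assign x c a y =>
    simp only [Atom.update]
    split_ifs
    · exact ⟨trivial, trivial⟩
    · trivial
  | eq => trivial
  | gt => trivial

theorem Atom.wellFormed_guardPrp {N : ℕ} (a : Atom) (C : Prp (N + 1)) :
    (a.guardPrp N).WellFormed C := by
  cases a <;> simp [Atom.guardPrp, Prp.WellFormed, isNat_reg]

theorem stateTy_valid {k N : ℕ} (idx : List Prog → Fin k) (l : List Prog) (C : Prp (N + 1)) :
    (stateTy N idx l).Valid C := by
  unfold stateTy
  split
  · exact ⟨⟨trivial, trivial⟩, fun _ => trivial⟩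
  · exact ⟨Atom.wellFormed_guardPrp _ _, Atom.isNat_update _ _⟩
  · exact fun _ _ => trivial
  · exact fun _ _ => trivial

theorem stateTy_inFragment {k N : ℕ} (idx : List Prog → Fin k) (l : List Prog) :
    (stateTy N idx l).InFragment := by
  unfold stateTy
  split
  · exact ⟨trivial, trivial⟩
  · rename_i a _
    exact ⟨by cases a <;> trivial, trivial⟩
  · exact fun _ => trivial
  · exact fun _ => trivial

/-! ### Bisimulations and type names -/

namespace Signature

variable {S : Signature}

theorem not_isName_unfold (v : Fin S.k) (e : Fin (S.arity v) → Exp 0) :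
    ¬ (S.unfold (.name v e)).IsName :=
  Ty.not_isName_subst (S.contractive v) e

/-- Type names related by a bisimulation have matching definitions, under either reading. -/
theorem IsBisimulation.matches_unfold {r : Reading} {R : S.ClosedTy → S.ClosedTy → Prop}
    (hR : S.IsBisimulation R r) {v w : Fin S.k} {e : Fin (S.arity v) → Exp 0}
    {f : Fin (S.arity w) → Exp 0} (h : R (.name v e) (.name w f)) :
    Matches R (S.unfold (.name v e)) (S.unfold (.name w f)) := by
  cases r with
  | equirecursive => exact hR _ _ h
  | isorecursive =>
    have h : R (S.unfold (.name v e)) (S.unfold (.name w f)) := by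
      cases hR _ _ h with
      | fold _ _ _ _ h => exact h
      | struct _ _ h => cases h
    generalize hA : S.unfold (.name v e) = A at h ⊢
    generalize S.unfold (.name w f) = B at h ⊢
    cases hR _ _ h with
    | fold v' _ e' _ _ => exact absurd ⟨v', e', hA⟩ (not_isName_unfold v e)
    | struct _ _ h => exact h

/-- To show equality of type names under both readings, it suffices to give a relation on type
names such that the definitions of related names match. -/
theorem equal_of_matches_unfold (r : Reading) {R : S.ClosedTy → S.ClosedTy → Prop}
    (hR : ∀ A B, R A B → A.IsName ∧ B.IsName ∧ Matches R (S.unfold A) (S.unfold B))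
    {A B : S.ClosedTy} (h : R A B) : S.Equal r A B := by
  have mono : ∀ {R' : S.ClosedTy → S.ClosedTy → Prop}, (∀ A B, R A B → R' A B) →
      ∀ A B, Matches R A B → Matches R' A B := by
    rintro R' h _ _ (⟨L, A, B, h1⟩ | ⟨L, A, B, h1⟩ | ⟨_, _, _, _, h1, h2⟩ | ⟨_, _, _, _, h1, h2⟩ |
      _ | ⟨_, _, _, _, h1⟩ | ⟨_, _, _, _, h1⟩ | ⟨_, _, h1⟩ | ⟨_, _, h1⟩)
    · exact .plus _ _ _ fun l => h _ _ (h1 l)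
    · exact .amp _ _ _ fun l => h _ _ (h1 l)
    · exact .tensor _ _ _ _ (h _ _ h1) (h _ _ h2)
    · exact .lolli _ _ _ _ (h _ _ h1) (h _ _ h2)
    · exact .one
    · exact .assert _ _ _ _ (h1.imp (fun h1 => ⟨h1.1, h1.2.1, h _ _ h1.2.2⟩) id)
    · exact .assume _ _ _ _ (h1.imp (fun h1 => ⟨h1.1, h1.2.1, h _ _ h1.2.2⟩) id)
    · exact .ex _ _ fun i => h _ _ (h1 i)
    · exact .all _ _ fun i => h _ _ (h1 i)
  cases r with
  | equirecursive => exact ⟨R, fun A B h => (hR A B h).2.2, h⟩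
  | isorecursive =>
    -- an unfolding step is a communication, so the unfolded types have to be related, too
    refine ⟨fun A B => R A B ∨ ∃ A' B', R A' B' ∧ A = S.unfold A' ∧ B = S.unfold B', ?_, .inl h⟩
    rintro A B (h | ⟨A, B, h, rfl, rfl⟩)
    · obtain ⟨⟨v, e, rfl⟩, ⟨w, f, rfl⟩, -⟩ := hR A B h
      exact .fold _ _ _ _ (.inr ⟨_, _, h, rfl, rfl⟩)
    · exact .struct _ _ (mono (fun _ _ => .inl) _ _ (hR A B h).2.2)

end Signature

namespace ControlSpace

variable (W : ControlSpace)

/-- The signature with one type name for each control state. -/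
def sig : Signature where
  k := W.k
  arity := fun _ => W.N + 1
  body := fun v => stateTy W.N W.idx (W.state v)
  contractive := fun v => not_isName_stateTy W.idx (W.state v)

/-- The closed type for a control state, applied to a flag and register contents. -/
def ty (l : List Prog) (e : Fin (W.N + 1) → Exp 0) : W.sig.ClosedTy := .name (W.idx l) e

/-- The closed expressions `e` denote the flag `b` and the register contents `s`. -/
def Denotes (e : Fin (W.N + 1) → Exp 0) (b : ℕ) (s : ℕ → ℕ) : Prop :=
  ∀ i, (e i).eval Fin.elim0 = withFlag b s i

variable {W}

theorem unfold_ty {l : List Prog} (hl : l ∈ W.carrier) (e : Fin (W.N + 1) → Exp 0) :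
    W.sig.unfold (W.ty l e) = (stateTy W.N W.idx l).subst e := by
  change (stateTy W.N W.idx (W.state (W.idx l))).subst e = _
  rw [W.state_idx l hl]

theorem Denotes.update {e : Fin (W.N + 1) → Exp 0} {b : ℕ} {s : ℕ → ℕ} (he : W.Denotes e b s)
    {a : Atom} (h : a.bound ≤ W.N) :
    W.Denotes (fun i => (a.update W.N i).subst e) b (a.next s) := fun i => by
  rw [Exp.eval_subst he, Atom.eval_update h]

theorem Denotes.valid_guard {e : Fin (W.N + 1) → Exp 0} {b : ℕ} {s : ℕ → ℕ}
    (he : W.Denotes e b s) {a : Atom} (h : a.bound ≤ W.N) :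
    ((a.guardPrp W.N).subst e).Valid ↔ a.Guard s :=
  (Prp.holds_subst _ he).trans (Atom.holds_guardPrp h b s)

theorem Denotes.valid_flag {e : Fin (W.N + 1) → Exp 0} {b : ℕ} {s : ℕ → ℕ}
    (he : W.Denotes e b s) :
    ((Prp.eq (.var 0) (.const 0) : Prp (W.N + 1)).subst e).Valid ↔ b = 0 := by
  refine (Prp.holds_subst _ he).trans ?_
  simp [Prp.Holds, Exp.eval, withFlag]

/-- Whenever a control state has a terminating run, the two values of the flag give types that are
not related by any bisimulation: the labels and assertions along the run lead to the final state,
where the flag is observed. -/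
theorem not_rel_of_accepts {r : Reading} {R : W.sig.ClosedTy → W.sig.ClosedTy → Prop}
    (hR : W.sig.IsBisimulation R r) {l : List Prog} {s : ℕ → ℕ} (h : Prog.Accepts l s)
    (hl : l ∈ W.carrier) {e f : Fin (W.N + 1) → Exp 0} (he : W.Denotes e 0 s)
    (hf : W.Denotes f 1 s) : ¬ R (W.ty l e) (W.ty l f) := by
  let Good (l : List Prog) (s : ℕ → ℕ) : Prop := l ∈ W.carrier → ∀ e f : Fin (W.N + 1) → Exp 0,
    W.Denotes e 0 s → W.Denotes f 1 s → ¬ R (W.ty l e) (W.ty l f)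
  have hmatch : ∀ {l}, l ∈ W.carrier → ∀ {e f}, R (W.ty l e) (W.ty l f) →
      Signature.Matches R ((stateTy W.N W.idx l).subst e) ((stateTy W.N W.idx l).subst f) := by
    intro l hl e f h
    rw [← unfold_ty hl, ← unfold_ty hl]
    exact hR.matches_unfold h
  have hplus : ∀ {L : Finset ℕ} {A B : L → W.sig.ClosedTy},
      Signature.Matches R (.plus L A) (.plus L B) → ∀ c, R (A c) (B c) := by
    rintro L A B ⟨⟩
    assumption
  have hassert : ∀ {φ ψ : Prp 0} {A B : W.sig.ClosedTy},
      Signature.Matches R (.assert φ A) (.assert ψ B) →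
        (φ.Valid ∧ ψ.Valid ∧ R A B) ∨ (φ.not.Valid ∧ ψ.not.Valid) := by
    rintro φ ψ A B ⟨⟩
    assumption
  have hrun : ∀ (p : Prog) (l : List Prog) (s t : ℕ → ℕ), p.Run s t → Good l t →
      Good (p :: l) s := by
    intro p
    induction p with
    | atom a =>
      rintro l s _ ⟨hg, rfl⟩ h hl e f he hf hr
      have ha := W.bound_le _ _ hl
      rcases hassert (hmatch hl hr) with ⟨-, -, h1⟩ | ⟨h1, -⟩
      · exact h (W.succs_subset _ hl rfl) _ _ (he.update ha) (hf.update ha) h1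
      · exact h1 ((he.valid_guard ha).2 hg)
    | seq p q ihp ihq =>
      rintro l s t ⟨u, hu, ht⟩ h hl e f he hf hr
      have h1 := hplus (hmatch hl hr) ⟨0, Finset.mem_singleton_self 0⟩
      exact ihp _ _ _ hu (ihq _ _ _ ht h) (W.succs_subset _ hl rfl) e f he hf h1
    | star p ih =>
      intro l s t hst h
      induction hst using Relation.ReflTransGen.head_induction_on with
      | refl =>
        intro hl e f he hf hr
        have h1 := hplus (hmatch hl hr) ⟨0, by simp⟩
        exact h (W.succs_subset _ hl (.inl rfl)) e f he hf h1
      | head hsu _ ih' =>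
        intro hl e f he hf hr
        have h1 := hplus (hmatch hl hr) ⟨1, by simp⟩
        exact ih _ _ _ hsu ih' (W.succs_subset _ hl (.inr rfl)) e f he hf h1
  have hgood : ∀ (l : List Prog) (s : ℕ → ℕ), Prog.Accepts l s → Good l s := by
    intro l
    induction l with
    | nil =>
      intro s _ hl e f he hf hr
      rcases hassert (hmatch hl hr) with ⟨-, h1, -⟩ | ⟨h1, -⟩
      · exact one_ne_zero (hf.valid_flag.1 h1)
      · exact h1 (he.valid_flag.2 rfl)
    | cons p l ih =>
      rintro s ⟨t, hp, ht⟩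
      exact hrun p l s t hp (ih t ht)
  exact hgood l s h hl e f he hf

/-- For a control state without terminating run the flag is never observed, so that its two
values give equal types. -/
theorem equal_of_not_accepts (r : Reading) {l : List Prog} {s : ℕ → ℕ}
    (h : ¬ Prog.Accepts l s) (hl : l ∈ W.carrier) {e f : Fin (W.N + 1) → Exp 0}
    (he : W.Denotes e 0 s) (hf : W.Denotes f 1 s) :
    W.sig.Equal r (W.ty l e) (W.ty l f) := by
  refine Signature.equal_of_matches_unfold r
    (R := fun A B => ∃ l ∈ W.carrier, ∃ s, ¬ Prog.Accepts l s ∧ ∃ e f, W.Denotes e 0 s ∧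
      W.Denotes f 1 s ∧ A = W.ty l e ∧ B = W.ty l f) ?_ ⟨l, hl, s, h, e, f, he, hf, rfl, rfl⟩
  rintro _ _ ⟨l, hl, s, h, e, f, he, hf, rfl, rfl⟩
  refine ⟨⟨_, _, rfl⟩, ⟨_, _, rfl⟩, ?_⟩
  rw [unfold_ty hl, unfold_ty hl]
  have hsub := W.succs_subset l hl
  match l, h, hl, hsub with
  | [], h, _, _ => exact absurd trivial h
  | .atom a :: l, h, hl, hsub =>
    have ha := W.bound_le _ _ hl
    refine .assert _ _ _ _ ?_
    by_cases hg : a.Guard s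
    · exact .inl ⟨(he.valid_guard ha).2 hg, (hf.valid_guard ha).2 hg, l, hsub rfl, a.next s,
        fun h' => h ⟨_, ⟨hg, rfl⟩, h'⟩, _, _, he.update ha, hf.update ha, rfl, rfl⟩
    · exact .inr ⟨mt (he.valid_guard ha).1 hg, mt (hf.valid_guard ha).1 hg⟩
  | .seq p q :: l, h, hl, hsub =>
    refine .plus _ _ _ fun _ => ⟨p :: q :: l, hsub rfl, s, ?_, e, f, he, hf, rfl, rfl⟩
    rintro ⟨t, ht, u, hu, h'⟩
    exact h ⟨u, ⟨t, ht, hu⟩, h'⟩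
  | .star p :: l, h, hl, hsub =>
    refine .plus _ _ _ fun c => ⟨if (c : ℕ) = 0 then l else p :: .star p :: l, ?_, s, ?_, e, f,
      he, hf, rfl, rfl⟩
    · split_ifs
      exacts [hsub (.inl rfl), hsub (.inr rfl)]
    · split_ifs
      · exact fun h' => h ⟨s, .refl, h'⟩
      · rintro ⟨t, ht, u, hu, h'⟩
        exact h ⟨u, .head ht hu, h'⟩

variable (W)

/-- The instance, without free variables, that asks whether the control state `l` has no
terminating run on the registers that all contain `x`. -/
def problem (l : List Prog) (x : ℕ) : Problem where
  sig := W.sig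
  n := 0
  C := .top
  A := W.ty l fun i => .const (withFlag 0 (fun _ => x) i)
  B := W.ty l fun i => .const (withFlag 1 (fun _ => x) i)

theorem problem_valid (l : List Prog) (x : ℕ) : (W.problem l x).Valid :=
  ⟨fun _ => stateTy_valid _ _ _, trivial, fun _ => trivial, fun _ => trivial⟩

theorem problem_inFragment (l : List Prog) (x : ℕ) : (W.problem l x).InFragment :=
  ⟨fun _ => stateTy_inFragment _ _, trivial, trivial, trivial⟩

variable {W}

theorem problem_holds_iff (r : Reading) {l : List Prog} (hl : l ∈ W.carrier) (x : ℕ) :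
    (W.problem l x).Holds r ↔ ¬ Prog.Accepts l fun _ => x := by
  have hd : ∀ b, W.Denotes (fun i => .const (withFlag b (fun _ => x) i)) b fun _ => x :=
    fun b i => rfl
  constructor
  · intro h ha
    obtain ⟨R, hR, h⟩ := h Fin.elim0 trivial
    exact not_rel_of_accepts hR ha hl (hd 0) (hd 1) h
  · exact fun h _ _ => equal_of_not_accepts r h hl (hd 0) (hd 1)

variable (W)

/-- Only the indices of the type names depend on `x`: the signature is fixed. -/
theorem computable_code_problem (l : List Prog) : Computable fun x => (W.problem l x).code := by
  have hpair : ∀ {f g : ℕ → ℕ}, Computable f → Computable g →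
      Computable fun x => Nat.pair (f x) (g x) :=
    fun hf hg => Primrec₂.natPair.to_comp.comp hf hg
  have hty : ∀ b, Computable fun x =>
      (W.ty l fun i => .const (withFlag b (fun _ => x) i)).code := by
    intro b
    simp only [ty, Ty.code, Exp.code]
    refine hpair (.const _) (hpair (.const _)
      (Computable.encode.comp (Computable.list_ofFn fun i => hpair (.const _) ?_)))
    obtain ⟨_ | r, _⟩ := i
    · exact .const b
    · exact .id
  simp only [Problem.code, problem]
  exact hpair (.const _) (hpair (.const _) (hpair (.const _) (hpair (hty 0) (hty 1))))

end ControlSpace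

/-! ### Undecidability -/

theorem DecidableOn.mono {P P' Q : Problem → Prop} (h : DecidableOn P Q)
    (hP : ∀ I, P' I → P I) : DecidableOn P' Q :=
  let ⟨d, hd, h⟩ := h
  ⟨d, hd, fun I hI => h I (hP I hI)⟩

/-- A decision procedure can be composed with a computable map into the admissible instances. -/
theorem DecidableOn.computablePred {α : Type} [Primcodable α] {P Q : Problem → Prop}
    (h : DecidableOn P Q) {g : α → Problem} (hg : Computable fun x => (g x).code)
    (hP : ∀ x, P (g x)) : ComputablePred fun x => Q (g x) := by
  classical
  obtain ⟨d, hd, h⟩ := h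
  refine ⟨inferInstance, (hd.comp hg).of_eq fun x => Part.eq_some_iff.2 ?_⟩
  by_cases hQ : Q (g x)
  · simpa [hQ] using (h _ (hP x)).1 hQ
  · simpa [hQ] using (h _ (hP x)).2 hQ

end SessionTypes

/-- Parametric type equality is undecidable, under the equirecursive and under the isorecursive
reading, on all valid instances and already on those in the quantifier-free fragment. -/
theorem theorem2 (r : SessionTypes.Reading) :
    ¬ SessionTypes.DecidableOn (fun I => I.Valid) (fun I => I.Holds r) ∧
    ¬ SessionTypes.DecidableOn (fun I => I.Valid ∧ I.InFragment) (fun I => I.Holds r) := by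
  suffices h : ¬ SessionTypes.DecidableOn (fun I => I.Valid ∧ I.InFragment)
      (fun I => I.Holds r) from ⟨fun h' => h (h'.mono fun _ => And.left), h⟩
  intro h
  -- the input `x` is the number of a code to be run on `0`
  obtain ⟨p, hp⟩ := SessionTypes.exists_prog_dom
    (f := fun x => (Denumerable.ofNat Nat.Partrec.Code x).eval 0)
    (Nat.Partrec.Code.eval_part.comp (Computable.ofNat _) (.const 0))
  obtain ⟨W, hW⟩ := SessionTypes.ControlSpace.exists_mem p
  have key := h.computablePred (g := fun c : Nat.Partrec.Code => W.problem [p] (Encodable.encode c))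
    ((W.computable_code_problem [p]).comp Computable.encode)
    fun c => ⟨W.problem_valid _ _, W.problem_inFragment _ _⟩
  refine ComputablePred.halting_problem 0 (key.not.of_eq fun c => ?_)
  rw [SessionTypes.ControlSpace.problem_holds_iff r hW, not_not]
  simpa [SessionTypes.Prog.Accepts] using hp fun _ => Encodable.encode c
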